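/- Let $M$ be a $C^\infty$ manifold of dimension $n$, and let $F$ be a Finsler metric on $M$: $F\ge 0$ is a function on $TM$, $C^\infty$ on $TM\setminus\{0\}$, with $F(x,y)=0$ iff $y=0$, $F(x,\lambda y)=\lambda F(x,y)$ for $\lambda\ge 0$, and with $g_{ij}=\frac12[F^2]_{y^iy^j}$ positive definite for $y\ne 0$. In standard local coordinates $(x^i,y^i)$ of $TM$ write $f_{\cdot i}=\partial f/\partial y^i$, and (summing over repeated indices) let $$G^i=\tfrac14 g^{il}\big\{[F^2]_{x^my^l}y^m-[F^2]_{x^l}\big\},$$ $$R^i_{\ k}=2\frac{\partial G^i}{\partial x^k}-\frac{\partial^2G^i}{\partial x^l\partial y^k}y^l+2G^l\frac{\partial^2G^i}{\partial y^l\partial y^k}-\frac{\partial G^i}{\partial y^l}\frac{\partial G^l}{\partial y^k}$$ be the geodesic coefficients and the Riemann curvature. Assume that $F$ is of scalar flag curvature ${\bf K}={\bf K}(x,y)$, that is, for every $y\neq0$ in $T_xM$ and every tangent plane $\Pi=\mathrm{span}\{y,u\}\subset T_xM$, $$\frac{g_{im}R^i_{\ k}u^ku^m}{F^2g_{ij}u^iu^j-[g_{ij}y^iu^j]^2}={\bf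 K}(x,y).$$ Let ${}_|$ denote the horizontal covariant derivative of the Berwald connection, so that for a covector $T_j=T_j(x,y)$ $$T_{j|i}=\frac{\partial T_j}{\partial x^i}-\frac{\partial G^m}{\partial y^i}\frac{\partial T_j}{\partial y^m}-\frac{\partial^2G^m}{\partial y^j\partial y^i}T_m .$$ Then, in every standard local coordinate system of $TM$, at every point with $y\ne0$ and for all indices $i,j,k$, $$({\bf K}_{\cdot j|i}-{\bf K}_{\cdot i|j})F_{\cdot k}+({\bf K}_{\cdot i|k}-{\bf K}_{\cdot k|i})F_{\cdot j}+({\bf K}_{\cdot k|j}-{\bf K}_{\cdot j|k})F_{\cdot i}=0 .$$ -/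

import Mathlib

open scoped Manifold ContDiff

noncomputable section

namespace Finsler

/-- The coordinate space `ℝⁿ`. -/
abbrev E (n : ℕ) : Type := EuclideanSpace ℝ (Fin n)

/-! ### Calculus in standard coordinates

A point of `E n × E n` is a pair `p = (x, y)`, where `x` are the coordinates of a point and
`y` the components of a tangent vector at that point. -/

section Local

variable {n : ℕ}

/-- The standard basis vector `eᵢ` of `ℝⁿ`. -/
def basisVec (i : Fin n) : E n := EuclideanSpace.single i (1 : ℝ)

/-- `∂f/∂xⁱ`. -/
def dx (i : Fin n) (f : E n × E n → ℝ) (p : E n × E n) : ℝ :=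
  fderiv ℝ f p (basisVec i, 0)

/-- `∂f/∂yⁱ`, also written `f_{·i}`. -/
def dy (i : Fin n) (f : E n × E n → ℝ) (p : E n × E n) : ℝ :=
  fderiv ℝ f p (0, basisVec i)

/-- The fundamental tensor `g_{ij} = ½ [F²]_{yⁱ yʲ}`. -/
def fundTensor (F : E n × E n → ℝ) (p : E n × E n) : Matrix (Fin n) (Fin n) ℝ :=
  Matrix.of fun i j => (1 / 2 : ℝ) * dy j (dy i (fun q => F q ^ 2)) p

/-- The geodesic coefficients
`Gⁱ = ¼ g^{il} ( [F²]_{xᵐ yˡ} yᵐ - [F²]_{xˡ} )`. -/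
def geodCoeff (F : E n × E n → ℝ) (i : Fin n) (p : E n × E n) : ℝ :=
  (1 / 4 : ℝ) * ∑ l, (fundTensor F p)⁻¹ i l *
    ((∑ m, dx m (dy l (fun q => F q ^ 2)) p * p.2 m) - dx l (fun q => F q ^ 2) p)

/-- The Riemann curvature
`Rⁱₖ = 2 ∂Gⁱ/∂xᵏ - yˡ ∂²Gⁱ/∂xˡ∂yᵏ + 2 Gˡ ∂²Gⁱ/∂yˡ∂yᵏ - (∂Gⁱ/∂yˡ) (∂Gˡ/∂yᵏ)`. -/
def riemannCurv (F : E n × E n → ℝ) (i k : Fin n) (p : E n × E n) : ℝ :=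
  2 * dx k (geodCoeff F i) p
    - (∑ l, dx l (dy k (geodCoeff F i)) p * p.2 l)
    + 2 * (∑ l, geodCoeff F l p * dy l (dy k (geodCoeff F i)) p)
    - ∑ l, dy l (geodCoeff F i) p * dy k (geodCoeff F l) p

/-- The flag curvature of the flag `span {y, u}` with flag pole `y` at `x`, where `p = (x, y)`:
`g_{im} Rⁱₖ uᵏ uᵐ / (F² g_{ij} uⁱ uʲ - (g_{ij} yⁱ uʲ)²)`. -/
def flagCurv (F : E n × E n → ℝ) (p : E n × E n) (u : E n) : ℝ :=
  (∑ i, ∑ m, ∑ k, fundTensor F p i m * riemannCurv F i k p * u k * u m) /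
    (F p ^ 2 * (∑ i, ∑ j, fundTensor F p i j * u i * u j)
      - (∑ i, ∑ j, fundTensor F p i j * p.2 i * u j) ^ 2)

/-- The horizontal derivative `δf/δxⁱ = ∂f/∂xⁱ - (∂Gᵐ/∂yⁱ) ∂f/∂yᵐ`. -/
def horDeriv (F : E n × E n → ℝ) (i : Fin n) (f : E n × E n → ℝ) (p : E n × E n) : ℝ :=
  dx i f p - ∑ m, dy i (geodCoeff F m) p * dy m f p

/-- The horizontal covariant derivative for the Berwald connection of a covector
`T = Tⱼ dxʲ` with components depending on `(x, y)`:
`T_{j|i} = δTⱼ/δxⁱ - Γᵐ_{ji} Tₘ`, where `Γᵐ_{ji} = ∂²Gᵐ/∂yʲ∂yⁱ`. -/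
def berwaldDeriv (F : E n × E n → ℝ) (T : Fin n → E n × E n → ℝ) (j i : Fin n)
    (p : E n × E n) : ℝ :=
  horDeriv F i (T j) p - ∑ m, dy i (dy j (geodCoeff F m)) p * T m p

/-- `K_{·j|i}`: the Berwald covariant derivative of the vertical differential of `K`. -/
def vertHor (F K : E n × E n → ℝ) (j i : Fin n) (p : E n × E n) : ℝ :=
  berwaldDeriv F (fun m => dy m K) j i p

end Local

/-! ### Finsler metrics on manifolds -/

section Manifold

variable {n : ℕ} {M : Type*} [TopologicalSpace M] [ChartedSpace (E n) M]

/-- The expression of a function `f` on `TM` in the standard coordinates `(x, y)` of `TM` induced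
by a chart `φ` of `M`: the value of `f` at the vector `yⁱ ∂/∂xⁱ` at the point with
coordinates `x`. -/
def coordRep (φ : OpenPartialHomeomorph M (E n)) (f : TangentBundle (𝓡 n) M → ℝ)
    (p : E n × E n) : ℝ :=
  f ⟨φ.symm p.1, mfderiv (𝓡 n) (𝓡 n) φ.symm p.1 p.2⟩

/-- Finsler metrics on a smooth `n`-manifold `M`. -/
structure IsFinslerMetric (F : TangentBundle (𝓡 n) M → ℝ) [IsManifold (𝓡 n) ∞ M] : Prop where
  smooth : ContMDiffOn (𝓡 n).tangent 𝓘(ℝ, ℝ) ∞ F {v | v.2 ≠ 0}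
  nonneg : ∀ v, 0 ≤ F v
  eq_zero_iff : ∀ v, F v = 0 ↔ v.2 = 0
  homogeneous : ∀ (x : M) (y : TangentSpace (𝓡 n) x) (c : ℝ), 0 ≤ c →
    F ⟨x, c • y⟩ = c * F ⟨x, y⟩
  strongly_convex : ∀ φ ∈ IsManifold.maximalAtlas (𝓡 n) ∞ M, ∀ x ∈ φ.target, ∀ y : E n, y ≠ 0 →
    (fundTensor (coordRep φ F) (x, y)).PosDef

/-- `F` is of scalar flag curvature `K = K(x, y)`: for each nonzero tangent vector `y` at a point
`x` and each tangent plane `Π = span {y, u}` containing `y`, the flag curvature of `(Π, y)`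
is `K(x, y)`. -/
def HasScalarFlagCurvature (F K : TangentBundle (𝓡 n) M → ℝ) [IsManifold (𝓡 n) ∞ M] : Prop :=
  ∀ φ ∈ IsManifold.maximalAtlas (𝓡 n) ∞ M, ∀ x ∈ φ.target, ∀ y u : E n,
    LinearIndependent ℝ ![y, u] →
      flagCurv (coordRep φ F) (x, y) u = coordRep φ K (x, y)

end Manifold

end Finsler

end

/-! ### Formal calculus of sprays: commutators and curvature -/

namespace Finsler

/-! Write L = F², S for the spray, δₖ for the horizontal fields, Rⁱₖ for the Riemann curvature and
Ωʳₖₗ for the curvature of the nonlinear connection, [δₖ, δₗ] = Ωʳₖₗ ∂/∂yʳ. Two general facts link R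
and Ω: the vertical curl of R is 3Ω (`Y_curv_sub`), and the Bianchi identity expresses the
derivative of Ω along S through the horizontal curl of R (`spray_conCurv`).

Scalar flag curvature means Rⁱₖ = K (L δⁱₖ - ½ yⁱ L_{·k}) (`two_mul_curv`). Tracing the first fact
expresses the trace of Ω through K and K_{·l}; differentiating this along S and comparing with the
traced Bianchi identity gives, after division by n - 2, 8 L δₗK = 2 L (SK)_{·l} + 3 (SK) L_{·l}
(`eight_mul_hor_scalar`). Since K_{·j|i} = ∂/∂yʲ (δᵢK), the vertical curl of this equation shows
that K_{·j|i} - K_{·i|j} is, up to the factor 3/(8L), the wedge product of the vertical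
differentials of SK and L. Its wedge with the differential of L = F², hence with that of F,
vanishes; this is the cyclic identity. For n ≤ 2 the identity is trivial, being alternating in three
indices.

The argument is purely algebraic, so it is run in a commutative algebra with commuting derivations
and then specialised to smooth functions on a chart domain with y ≠ 0. The function K is not assumed
smooth; its smoothness is derived in `exists_represents_scalar`. -/

/-- A commutative algebra of functions of `(x, y)`, with the derivations `∂/∂xⁱ`, `∂/∂yⁱ` and the
coordinate functions `yⁱ`. -/
structure Calculus (ι A : Type*) [DecidableEq ι] [CommRing A] [Algebra ℝ A] where
  X : ι → Derivation ℝ A A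
  Y : ι → Derivation ℝ A A
  y : ι → A
  XX : ∀ i j a, X i (X j a) = X j (X i a)
  YX : ∀ i j a, Y i (X j a) = X j (Y i a)
  YY : ∀ i j a, Y i (Y j a) = Y j (Y i a)
  X_y : ∀ i j, X i (y j) = 0
  Y_y : ∀ i j, Y i (y j) = if i = j then 1 else 0

namespace Calculus

variable {ι A : Type*} [Fintype ι] [DecidableEq ι] [CommRing A] [Algebra ℝ A]
  (C : Calculus ι A) (G : ι → A)

theorem isUnit_natCast {m : ℕ} (hm : m ≠ 0) : IsUnit (m : A) := by
  have h : IsUnit (m : ℝ) := by simpa using hm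
  simpa using h.map (algebraMap ℝ A)

theorem isUnit_two : IsUnit (2 : A) := by
  exact_mod_cast isUnit_natCast (A := A) two_ne_zero

/-- The Euler field `yⁱ ∂/∂yⁱ`. -/
def euler : Derivation ℝ A A := ∑ i, C.y i • C.Y i

/-- The spray `yⁱ ∂/∂xⁱ - 2 Gⁱ ∂/∂yⁱ`. -/
def spray : Derivation ℝ A A := ∑ i, C.y i • C.X i - (2 : A) • ∑ i, G i • C.Y i

/-- The horizontal field `δ/δxᵏ`. -/
def hor (k : ι) : Derivation ℝ A A := C.X k - ∑ m, C.Y k (G m) • C.Y m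

/-- The Riemann curvature of a spray. -/
def curv (i k : ι) : A :=
  2 * C.X k (G i) - (∑ l, C.X l (C.Y k (G i)) * C.y l)
    + 2 * (∑ l, G l * C.Y l (C.Y k (G i))) - ∑ l, C.Y l (G i) * C.Y k (G l)

/-- The curvature of the nonlinear connection: `[δₖ, δₗ] = Ωʳₖₗ ∂/∂yʳ`. -/
def conCurv (k l r : ι) : A := C.hor G l (C.Y k (G r)) - C.hor G k (C.Y l (G r))

theorem derivation_sum_apply {κ : Type*} (s : Finset κ) (D : κ → Derivation ℝ A A) (f : A) :
    (∑ i ∈ s, D i) f = ∑ i ∈ s, D i f := by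
  rw [← Derivation.coeFnAddMonoidHom_apply, map_sum, Finset.sum_apply]
  rfl

theorem euler_apply (f : A) : C.euler f = ∑ i, C.y i * C.Y i f := by
  simp [euler, derivation_sum_apply]

theorem spray_apply (f : A) :
    C.spray G f = ∑ i, C.y i * C.X i f - 2 * ∑ i, G i * C.Y i f := by
  simp [spray, derivation_sum_apply]

theorem hor_apply (k : ι) (f : A) :
    C.hor G k f = C.X k f - ∑ m, C.Y k (G m) * C.Y m f := by
  simp [hor, derivation_sum_apply]

theorem derivation_sum_mul {κ : Type*} [Fintype κ] (D : Derivation ℝ A A) (a b : κ → A) :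
    D (∑ i, a i * b i) = ∑ i, D (a i) * b i + ∑ i, a i * D (b i) := by
  rw [map_sum, ← Finset.sum_add_distrib]
  refine Finset.sum_congr rfl fun i _ => ?_
  rw [D.leibniz]
  simp only [smul_eq_mul]
  ring

theorem derivation_mul (D : Derivation ℝ A A) (a b : A) : D (a * b) = D a * b + a * D b := by
  rw [D.leibniz]
  simp only [smul_eq_mul]
  ring

theorem derivation_natCast_mul (D : Derivation ℝ A A) (m : ℕ) (a : A) :
    D ((m : A) * a) = m * D a := by
  rw [derivation_mul, D.map_natCast, zero_mul, zero_add]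

theorem derivation_two_mul (D : Derivation ℝ A A) (a : A) : D (2 * a) = 2 * D a := by
  exact_mod_cast derivation_natCast_mul D 2 a

/-! ### Commutators -/

theorem Y_euler (k : ι) (f : A) : C.Y k (C.euler f) = C.euler (C.Y k f) + C.Y k f := by
  simp only [euler_apply, derivation_sum_mul, C.Y_y, ite_mul, one_mul, zero_mul,
    Finset.sum_ite_eq, Finset.mem_univ, if_true]
  rw [add_comm]
  simp only [C.YY k]

theorem X_euler (k : ι) (f : A) : C.X k (C.euler f) = C.euler (C.X k f) := by
  simp only [euler_apply, derivation_sum_mul, C.X_y, zero_mul, Finset.sum_const_zero, zero_add,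
    C.YX]

theorem Y_spray (k : ι) (f : A) :
    C.Y k (C.spray G f) = C.spray G (C.Y k f) + C.hor G k f - ∑ m, C.Y k (G m) * C.Y m f := by
  simp only [spray_apply, hor_apply, map_sub, derivation_two_mul, derivation_sum_mul, C.Y_y,
    ite_mul, one_mul, zero_mul, Finset.sum_ite_eq, Finset.mem_univ, if_true, C.YX, C.YY k]
  ring

theorem Y_hor (l k : ι) (f : A) :
    C.Y l (C.hor G k f) = C.hor G k (C.Y l f) - ∑ m, C.Y l (C.Y k (G m)) * C.Y m f := by
  simp only [hor_apply, map_sub, derivation_sum_mul, C.YX, C.YY l _ f]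
  ring

theorem X_spray (k : ι) (f : A) :
    C.X k (C.spray G f) = C.spray G (C.X k f) - 2 * ∑ m, C.X k (G m) * C.Y m f := by
  simp only [spray_apply, map_sub, derivation_two_mul, derivation_sum_mul, C.X_y, zero_mul,
    Finset.sum_const_zero, C.XX k, C.YX]
  ring

theorem curv_eq (i k : ι) :
    C.curv G i k = 2 * C.X k (G i) - C.spray G (C.Y k (G i)) - ∑ l, C.Y l (G i) * C.Y k (G l) := by
  simp only [curv, spray_apply, mul_comm (C.y _)]
  ring

/-- The Riemann curvature is the vertical part of [S, δₖ]. This form lets R be read off by applying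
the commutator to functions killed by S and δₖ. -/
theorem spray_hor (k : ι) (f : A) :
    C.spray G (C.hor G k f) = C.hor G k (C.spray G f) + ∑ m, C.Y k (G m) * C.hor G m f
      + ∑ m, C.curv G m k * C.Y m f := by
  have h1 : ∑ m, C.Y k (G m) * C.Y m (C.spray G f) = ∑ m, C.Y k (G m) * C.spray G (C.Y m f)
      + ∑ m, C.Y k (G m) * C.hor G m f
      - ∑ r, (∑ m, C.Y m (G r) * C.Y k (G m)) * C.Y r f := by
    simp only [Y_spray, mul_sub, mul_add, Finset.sum_sub_distrib, Finset.sum_add_distrib,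
      Finset.mul_sum, Finset.sum_mul]
    rw [Finset.sum_comm]
    congr 1
    refine Finset.sum_congr rfl fun i _ => Finset.sum_congr rfl fun j _ => by ring
  have h2 : ∑ m, C.curv G m k * C.Y m f = 2 * ∑ m, C.X k (G m) * C.Y m f
      - ∑ m, C.spray G (C.Y k (G m)) * C.Y m f
      - ∑ r, (∑ m, C.Y m (G r) * C.Y k (G m)) * C.Y r f := by
    simp only [curv_eq, sub_mul, Finset.sum_sub_distrib, Finset.mul_sum, mul_assoc]
  rw [h2, C.hor_apply G k f, C.hor_apply G k (C.spray G f), h1, map_sub, derivation_sum_mul,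
    X_spray]
  ring

theorem hor_hor (k l : ι) (f : A) :
    C.hor G k (C.hor G l f) = C.hor G l (C.hor G k f) + ∑ m, C.conCurv G k l m * C.Y m f := by
  have h1 : C.X l (C.hor G k f) = C.hor G k (C.X l f)
      - ∑ m, C.X l (C.Y k (G m)) * C.Y m f := by
    simp only [hor_apply, map_sub, derivation_sum_mul, C.XX l, C.YX]
    ring
  have h2 : ∑ m, C.Y l (G m) * C.Y m (C.hor G k f) = ∑ m, C.Y l (G m) * C.hor G k (C.Y m f)
      - ∑ r, (∑ m, C.Y l (G m) * C.Y m (C.Y k (G r))) * C.Y r f := by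
    simp only [Y_hor, mul_sub, Finset.sum_sub_distrib, Finset.mul_sum, Finset.sum_mul]
    rw [Finset.sum_comm]
    congr 1
    refine Finset.sum_congr rfl fun i _ => Finset.sum_congr rfl fun j _ => by ring
  have h3 : ∑ m, C.conCurv G k l m * C.Y m f = ∑ m, C.X l (C.Y k (G m)) * C.Y m f
      - ∑ r, (∑ m, C.Y l (G m) * C.Y m (C.Y k (G r))) * C.Y r f
      - ∑ m, C.hor G k (C.Y l (G m)) * C.Y m f := by
    simp only [conCurv, C.hor_apply G l (C.Y k _), sub_mul, Finset.sum_sub_distrib]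
  rw [h3, C.hor_apply G l f, C.hor_apply G l (C.hor G k f), map_sub, derivation_sum_mul, h1, h2]
  ring

/-! ### The curvature of a spray -/

/-- Terms symmetric in k, l drop out. Of the factor 3, two come from the term 2 ∂Gʳ/∂xˡ of the
curvature and one from commuting ∂/∂yᵏ with S. -/
theorem Y_curv_sub (k l r : ι) :
    C.Y k (C.curv G r l) - C.Y l (C.curv G r k) = 3 * C.conCurv G k l r := by
  have e : ∀ k l, C.Y k (C.curv G r l) = 2 * C.X l (C.Y k (G r)) - C.spray G (C.Y k (C.Y l (G r)))
      - C.hor G k (C.Y l (G r)) + ∑ m, C.Y k (G m) * C.Y m (C.Y l (G r))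
      - ∑ m, C.Y k (C.Y m (G r)) * C.Y l (G m) - ∑ m, C.Y m (G r) * C.Y k (C.Y l (G m)) := by
    intro k l
    simp only [curv_eq, map_sub, derivation_two_mul, derivation_sum_mul, C.YX, Y_spray]
    ring
  have s : ∀ k l, ∑ m, C.Y k (C.Y m (G r)) * C.Y l (G m)
      = ∑ m, C.Y l (G m) * C.Y m (C.Y k (G r)) := by
    intro k l
    refine Finset.sum_congr rfl fun m _ => by rw [C.YY k m]; ring
  have h : ∀ k l, C.X l (C.Y k (G r)) = C.hor G l (C.Y k (G r))
      + ∑ m, C.Y l (G m) * C.Y m (C.Y k (G r)) := by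
    intro k l
    rw [hor_apply]
    ring
  rw [e k l, e l k, s k l, s l k, h k l, h l k, conCurv, C.YY k l (G r)]
  simp only [C.YY l k]
  ring

theorem spray_Y_apply (k r : ι) :
    C.spray G (C.Y k (G r)) = 2 * C.hor G k (G r) + ∑ m, C.Y k (G m) * C.Y m (G r)
      - C.curv G r k := by
  rw [curv_eq, hor_apply]
  simp only [mul_comm (C.Y k (G _))]
  ring

/-- Bianchi identity. Commuting S past δₗ and using the definition of R for S(∂Gʳ/∂yᵏ) leaves second
horizontal derivatives of Gʳ, whose antisymmetrisation is again given by Ω. -/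
theorem spray_conCurv (k l r : ι) :
    C.spray G (C.conCurv G k l r) = C.hor G k (C.curv G r l) - C.hor G l (C.curv G r k)
      + ∑ m, C.curv G m l * C.Y m (C.Y k (G r)) - ∑ m, C.curv G m k * C.Y m (C.Y l (G r))
      + ∑ m, C.Y k (G m) * C.conCurv G m l r - ∑ m, C.Y l (G m) * C.conCurv G m k r
      - ∑ m, C.conCurv G k l m * C.Y m (G r) := by
  have e : ∀ k l, C.spray G (C.hor G l (C.Y k (G r))) = 2 * C.hor G l (C.hor G k (G r))
      + ∑ m, C.hor G l (C.Y k (G m)) * C.Y m (G r) + ∑ m, C.Y k (G m) * C.hor G l (C.Y m (G r))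
      - C.hor G l (C.curv G r k) + ∑ m, C.Y l (G m) * C.hor G m (C.Y k (G r))
      + ∑ m, C.curv G m l * C.Y m (C.Y k (G r)) := by
    intro k l
    rw [spray_hor, spray_Y_apply, map_sub, map_add, derivation_two_mul, derivation_sum_mul]
    ring
  have h := C.hor_hor G k l (G r)
  have h1 : ∑ m, C.conCurv G k l m * C.Y m (G r) = ∑ m, C.hor G l (C.Y k (G m)) * C.Y m (G r)
      - ∑ m, C.hor G k (C.Y l (G m)) * C.Y m (G r) := by
    simp only [conCurv, sub_mul, Finset.sum_sub_distrib]
  have h2 : ∀ k l, ∑ m, C.Y k (G m) * C.conCurv G m l r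
      = ∑ m, C.Y k (G m) * C.hor G l (C.Y m (G r))
        - ∑ m, C.Y k (G m) * C.hor G m (C.Y l (G r)) := by
    intro k l
    simp only [conCurv, mul_sub, Finset.sum_sub_distrib]
  conv_lhs => rw [conCurv, map_sub, e k l, e l k]
  rw [h2 k l, h2 l k, h]
  linear_combination (-1 : A) * h1

/-- The contracted Bianchi identity. -/
theorem spray_trace_conCurv (l : ι) :
    C.spray G (∑ k, C.conCurv G k l k) = ∑ k, C.hor G k (C.curv G k l)
      - C.hor G l (∑ k, C.curv G k k)
      + ∑ k, ∑ m, C.curv G m l * C.Y m (C.Y k (G k))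
      - ∑ k, ∑ m, C.curv G m k * C.Y m (C.Y l (G k))
      + ∑ m, C.Y l (G m) * ∑ k, C.conCurv G k m k := by
  have h1 : ∑ k, ∑ m, C.Y k (G m) * C.conCurv G m l k
      = ∑ k, ∑ m, C.conCurv G k l m * C.Y m (G k) := by
    rw [Finset.sum_comm]
    exact Finset.sum_congr rfl fun i _ => Finset.sum_congr rfl fun j _ => by ring
  have h2 : ∑ k, ∑ m, C.Y l (G m) * C.conCurv G m k k
      = - ∑ m, C.Y l (G m) * ∑ k, C.conCurv G k m k := by
    rw [Finset.sum_comm, ← Finset.sum_neg_distrib]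
    refine Finset.sum_congr rfl fun i _ => ?_
    rw [← mul_neg, ← Finset.sum_neg_distrib, Finset.mul_sum]
    exact Finset.sum_congr rfl fun j _ => by simp only [conCurv]; ring
  simp only [map_sum, spray_conCurv, Finset.sum_sub_distrib, Finset.sum_add_distrib, h1, h2]
  ring

end Calculus
end Finsler

/-! ### Energy functions: homogeneity, symmetry of the curvature, scalar curvature -/

namespace Finsler
namespace Calculus

variable {ι A : Type*} [Fintype ι] [DecidableEq ι] [CommRing A] [Algebra ℝ A]

/-- `L` is the square of a Finsler function with geodesic coefficients `G`. -/
structure IsEnergy (C : Calculus ι A) (L : A) (G : ι → A) : Prop where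
  isUnit : IsUnit L
  euler : C.euler L = 2 * L
  spray : ∀ l, C.spray G (C.Y l L) = C.X l L
  nondegenerate : ∀ v : ι → A, (∀ l, ∑ i, C.Y l (C.Y i L) * v i = 0) → ∀ i, v i = 0

namespace IsEnergy

variable {C : Calculus ι A} {L : A} {G : ι → A} (h : C.IsEnergy L G)
include h

theorem euler_Y (k : ι) : C.euler (C.Y k L) = C.Y k L := by
  have := C.Y_euler k L
  rw [h.euler, derivation_two_mul] at this
  linear_combination -this

theorem sum_hessian_mul_y (k : ι) : ∑ i, C.Y k (C.Y i L) * C.y i = C.Y k L := by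
  rw [← h.euler_Y k, C.euler_apply]
  refine Finset.sum_congr rfl fun i _ => by rw [C.YY, mul_comm]

/-- Apply S to yⁱ L_{·i} = 2L: since S(yⁱ) = -2Gⁱ and S(L_{·i}) = ∂L/∂xⁱ, the result is 2 SL = SL.
-/
theorem spray_self : C.spray G L = 0 := by
  have h1 : C.spray G (C.euler L) = ∑ i, C.spray G (C.y i) * C.Y i L + ∑ i, C.y i * C.X i L := by
    rw [C.euler_apply, derivation_sum_mul]
    simp only [h.spray]
  have h2 : ∀ i, C.spray G (C.y i) = - (2 * G i) := by
    intro i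
    simp [spray_apply, C.X_y, C.Y_y]
  have h3 := C.spray_apply G L
  simp only [h2, neg_mul, Finset.sum_neg_distrib, mul_assoc, ← Finset.mul_sum] at h1
  rw [h.euler, derivation_two_mul] at h1
  linear_combination h1 - h3

/-- Differentiating SL = 0 in yᵏ and using the Euler–Lagrange equation gives 2 δₖL = 0. -/
theorem hor_self (k : ι) : C.hor G k L = 0 := by
  have h1 := C.Y_spray G k L
  rw [h.spray_self, map_zero, h.spray] at h1
  refine isUnit_two.mul_right_eq_zero.1 ?_
  linear_combination -h1 + C.hor_apply G k L

theorem X_self (k : ι) : C.X k L = ∑ m, C.Y k (G m) * C.Y m L := by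
  linear_combination h.hor_self k - C.hor_apply G k L

/-- Both sides of the Euler–Lagrange equation are compared under the Euler field; the defect from
degree 2 is annihilated by the Hessian of L, hence zero. -/
theorem euler_geod (i : ι) : C.euler (G i) = 2 * G i := by
  refine sub_eq_zero.1 (h.nondegenerate (fun i => C.euler (G i) - 2 * G i) (fun l => ?_) i)
  have hY : ∀ m, C.euler (C.Y m (C.Y l L)) = 0 := by
    intro m
    have := C.Y_euler m (C.Y l L)
    rw [h.euler_Y] at this
    linear_combination -this
  have hX : ∀ m, C.euler (C.X m (C.Y l L)) = C.X m (C.Y l L) := by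
    intro m
    rw [← X_euler, h.euler_Y]
  have hy : ∀ m, C.euler (C.y m) = C.y m := by
    intro m
    simp [euler_apply, C.Y_y]
  have hl : C.euler (C.spray G (C.Y l L)) = 2 * C.X l L := by
    rw [h.spray, ← X_euler, h.euler, derivation_two_mul]
  have hs := C.spray_apply G (C.Y l L)
  rw [h.spray] at hs
  rw [spray_apply, map_sub, derivation_two_mul, derivation_sum_mul, derivation_sum_mul] at hl
  simp only [hY, hX, hy, mul_zero, Finset.sum_const_zero, add_zero] at hl
  have e : ∀ i, C.Y l (C.Y i L) * (C.euler (G i) - 2 * G i)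
      = C.euler (G i) * C.Y i (C.Y l L) - 2 * (G i * C.Y i (C.Y l L)) := by
    intro i
    rw [C.YY l i]
    ring
  simp only [e, Finset.sum_sub_distrib, ← Finset.mul_sum]
  refine isUnit_two.mul_right_eq_zero.1 ?_
  linear_combination -hl - 2 * hs

theorem euler_Y_geod (i k : ι) : C.euler (C.Y k (G i)) = C.Y k (G i) := by
  have := C.Y_euler k (G i)
  rw [h.euler_geod, derivation_two_mul] at this
  linear_combination -this

theorem euler_spray (f : A) :
    C.euler (C.spray G f) = C.spray G (C.euler f) + C.spray G f := by
  have hX : ∀ m, C.euler (C.X m f) = C.X m (C.euler f) := fun m => (C.X_euler m f).symm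
  have hY : ∀ m, C.euler (C.Y m f) = C.Y m (C.euler f) - C.Y m f := by
    intro m
    rw [Y_euler]
    ring
  have hy : ∀ m, C.euler (C.y m) = C.y m := by
    intro m
    simp [euler_apply, C.Y_y]
  rw [spray_apply, spray_apply, map_sub, derivation_two_mul, derivation_sum_mul,
    derivation_sum_mul]
  simp only [hX, hY, hy, h.euler_geod, mul_sub, Finset.sum_sub_distrib, mul_assoc,
    ← Finset.mul_sum]
  ring

theorem euler_curv (i k : ι) : C.euler (C.curv G i k) = 2 * C.curv G i k := by
  rw [curv_eq, map_sub, map_sub, derivation_two_mul, derivation_sum_mul, h.euler_spray,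
    ← X_euler]
  simp only [h.euler_geod, h.euler_Y_geod, derivation_two_mul]
  ring

theorem curv_mul_y (i : ι) : ∑ k, C.curv G i k * C.y k = 0 := by
  have hS : ∑ k, C.spray G (C.Y k (G i)) * C.y k
      = 2 * C.spray G (G i) + 2 * ∑ k, C.Y k (G i) * G k := by
    have h1 : C.spray G (C.euler (G i)) = ∑ k, C.spray G (C.y k) * C.Y k (G i)
        + ∑ k, C.y k * C.spray G (C.Y k (G i)) := by
      rw [C.euler_apply, derivation_sum_mul]
    have h2 : ∀ k, C.spray G (C.y k) = - (2 * G k) := by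
      intro k
      simp [spray_apply, C.X_y, C.Y_y]
    rw [h.euler_geod, derivation_two_mul] at h1
    simp only [h2, neg_mul, Finset.sum_neg_distrib, mul_assoc, ← Finset.mul_sum,
      mul_comm (G _)] at h1
    simp only [mul_comm _ (C.y _)]
    linear_combination -h1
  have hN : ∑ k, (∑ l, C.Y l (G i) * C.Y k (G l)) * C.y k = 2 * ∑ l, C.Y l (G i) * G l := by
    have : ∀ l, ∑ k, C.Y k (G l) * C.y k = 2 * G l := by
      intro l
      rw [← h.euler_geod, euler_apply]
      exact Finset.sum_congr rfl fun k _ => mul_comm _ _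
    simp only [Finset.sum_mul, mul_assoc]
    rw [Finset.sum_comm]
    simp only [← Finset.mul_sum, this]
    rw [Finset.mul_sum]
    exact Finset.sum_congr rfl fun k _ => by ring
  have hs := C.spray_apply G (G i)
  simp only [curv_eq, sub_mul, Finset.sum_sub_distrib, hS, hN, mul_assoc, ← Finset.mul_sum]
  simp only [mul_comm (C.y _), mul_comm (G _)] at hs ⊢
  linear_combination -2 * hs

/-- S and all δₖ kill L, so only the curvature term of [S, δₖ]L remains. -/
theorem curv_mul_Y_self (k : ι) : ∑ i, C.curv G i k * C.Y i L = 0 := by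
  have := C.spray_hor G k L
  simp only [h.hor_self, h.spray_self, map_zero, mul_zero, Finset.sum_const_zero, zero_add] at this
  exact this.symm

theorem conCurv_mul_Y_self (k l : ι) : ∑ i, C.conCurv G k l i * C.Y i L = 0 := by
  have := C.hor_hor G k l L
  simp only [h.hor_self, map_zero, zero_add] at this
  exact this.symm

/-- Differentiating Rⁱₖ L_{·i} = 0 in yᵐ turns the asymmetry into the vertical curl of R, which is
3Ω, contracted with L_{·i}; this vanishes. -/
theorem hessian_mul_curv_comm (m k : ι) :
    ∑ i, C.Y m (C.Y i L) * C.curv G i k = ∑ i, C.Y k (C.Y i L) * C.curv G i m := by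
  have e : ∀ m k, ∑ i, C.Y m (C.Y i L) * C.curv G i k
      = - ∑ i, C.Y m (C.curv G i k) * C.Y i L := by
    intro m k
    have := congrArg (C.Y m) (h.curv_mul_Y_self k)
    rw [derivation_sum_mul, map_zero] at this
    simp only [mul_comm (C.Y m (C.Y _ L))]
    linear_combination this
  rw [e, e, neg_inj, ← sub_eq_zero, ← Finset.sum_sub_distrib]
  simp only [← sub_mul, Y_curv_sub, mul_assoc, ← Finset.mul_sum, h.conCurv_mul_Y_self, mul_zero]

section Scalar

variable {K : A} (hK : ∀ m k, ∑ i, C.Y m (C.Y i L) * C.curv G i k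
  + ∑ i, C.Y k (C.Y i L) * C.curv G i m = K * (2 * L * C.Y m (C.Y k L) - C.Y m L * C.Y k L))
include hK

/-- The flag condition controls only the symmetric part of g_{im} Rⁱₖ; by `hessian_mul_curv_comm`
that is everything, and nondegeneracy removes the Hessian. -/
theorem two_mul_curv (i k : ι) :
    2 * C.curv G i k = K * (2 * L * (if i = k then 1 else 0) - C.y i * C.Y k L) := by
  refine sub_eq_zero.1 (h.nondegenerate (fun i => 2 * C.curv G i k
    - K * (2 * L * (if i = k then 1 else 0) - C.y i * C.Y k L)) (fun m => ?_) i)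
  have e : ∀ i, C.Y m (C.Y i L) * (2 * C.curv G i k
      - K * (2 * L * (if i = k then 1 else 0) - C.y i * C.Y k L))
      = 2 * (C.Y m (C.Y i L) * C.curv G i k)
        - 2 * K * L * (if i = k then C.Y m (C.Y i L) else 0)
        + K * C.Y k L * (C.Y m (C.Y i L) * C.y i) := by
    intro i
    split_ifs <;> ring
  simp only [e, Finset.sum_add_distrib, Finset.sum_sub_distrib, ← Finset.mul_sum,
    h.sum_hessian_mul_y, Finset.sum_ite_eq', Finset.mem_univ, if_true]
  have h1 := hK m k
  rw [← h.hessian_mul_curv_comm m k] at h1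
  linear_combination h1

theorem trace_curv : ∑ k, C.curv G k k = ((Fintype.card ι : A) - 1) * (K * L) := by
  refine isUnit_two.mul_left_cancel ?_
  have h1 := h.euler
  rw [euler_apply] at h1
  simp only [Finset.mul_sum, h.two_mul_curv hK, if_true, mul_one]
  rw [← Finset.mul_sum, Finset.sum_sub_distrib, h1]
  simp only [Finset.sum_const, Finset.card_univ, nsmul_eq_mul]
  ring

/-- The trace (n - 1) K L and L are both homogeneous of degree 2, so K has degree 0. -/
theorem euler_scalar (hn : 2 ≤ Fintype.card ι) : C.euler K = 0 := by
  have h1 := congrArg C.euler (h.trace_curv hK)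
  simp only [map_sum, h.euler_curv] at h1
  rw [← Finset.mul_sum, h.trace_curv hK, derivation_mul, derivation_mul, h.euler, map_sub,
    Derivation.map_natCast, Derivation.map_one_eq_zero] at h1
  obtain ⟨m, hm⟩ := Nat.exists_eq_add_of_le hn
  -- Here m + 1 = n - 1.
  have h2 : ((m + 1 : ℕ) : A) * (L * C.euler K) = 0 := by
    rw [hm] at h1
    push_cast at h1 ⊢
    linear_combination -h1
  exact h.isUnit.mul_right_eq_zero.1 ((isUnit_natCast (Nat.succ_ne_zero m)).mul_right_eq_zero.1 h2)

end Scalar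

end IsEnergy
end Calculus
end Finsler

/-! ### The Bianchi identity for scalar curvature and the cyclic identity -/

namespace Finsler
namespace Calculus

variable {ι A : Type*} [Fintype ι] [DecidableEq ι] [CommRing A] [Algebra ℝ A]

namespace IsEnergy

variable {C : Calculus ι A} {L : A} {G : ι → A} (h : C.IsEnergy L G)
include h

theorem sum_y_mul_hor (f : A) : ∑ k, C.y k * C.hor G k f = C.spray G f := by
  have e : ∀ m, ∑ k, C.y k * C.Y k (G m) = 2 * G m := by
    intro m
    rw [← h.euler_geod, euler_apply]
  simp only [hor_apply, mul_sub, Finset.sum_sub_distrib, Finset.mul_sum, spray_apply]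
  rw [Finset.sum_comm]
  congr 1
  refine Finset.sum_congr rfl fun m _ => ?_
  rw [← mul_assoc, ← e, Finset.sum_mul]
  exact Finset.sum_congr rfl fun k _ => by ring

section Scalar

variable {K : A} (hK : ∀ m k, ∑ i, C.Y m (C.Y i L) * C.curv G i k
  + ∑ i, C.Y k (C.Y i L) * C.curv G i m = K * (2 * L * C.Y m (C.Y k L) - C.Y m L * C.Y k L))
include hK

theorem two_mul_sum_curv_mul (a : ι → A) (l : ι) :
    2 * ∑ m, C.curv G m l * a m = K * (2 * L * a l - (∑ m, C.y m * a m) * C.Y l L) := by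
  have e : ∀ m, 2 * (C.curv G m l * a m) = (if m = l then 2 * (K * L) * a m else 0)
      - K * C.Y l L * (C.y m * a m) := by
    intro m
    rw [← mul_assoc, h.two_mul_curv hK]
    split_ifs <;> ring
  rw [Finset.mul_sum]
  simp only [e, Finset.sum_sub_distrib, Finset.sum_ite_eq', Finset.mem_univ, if_true,
    ← Finset.mul_sum]
  ring

theorem two_mul_sum_derivation_curv (D : ι → Derivation ℝ A A) (l : ι) :
    2 * ∑ k, D k (C.curv G k l) = 2 * D l (K * L) - (∑ k, C.y k * D k K) * C.Y l L
      - K * (∑ k, D k (C.y k)) * C.Y l L - K * ∑ k, C.y k * D k (C.Y l L) := by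
  have e : ∀ k, 2 * D k (C.curv G k l) = (if k = l then 2 * D k (K * L) else 0)
      - C.Y l L * (C.y k * D k K) - K * C.Y l L * (D k (C.y k))
      - K * (C.y k * D k (C.Y l L)) := by
    intro k
    rw [← derivation_two_mul, h.two_mul_curv hK]
    split_ifs
    · rw [mul_one, mul_sub, map_sub, mul_left_comm, derivation_two_mul, derivation_mul _ K (_ * _),
        derivation_mul _ (C.y k)]
      ring
    · rw [mul_zero, zero_sub, mul_neg, map_neg, derivation_mul, derivation_mul _ (C.y k)]
      ring
  rw [Finset.mul_sum]
  simp only [e, Finset.sum_sub_distrib, Finset.sum_ite_eq', Finset.mem_univ, if_true,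
    ← Finset.mul_sum]
  ring

/-- Trace of `Y_curv_sub` with the scalar form of R inserted; homogeneity of K removes yᵏ K_{·k}. -/
theorem six_mul_trace_conCurv (hn : 2 ≤ Fintype.card ι) (l : ι) :
    6 * ∑ k, C.conCurv G k l k = -(2 * ((Fintype.card ι : A) - 2) * L * C.Y l K)
      - 3 * ((Fintype.card ι : A) - 1) * K * C.Y l L := by
  have h1 : 3 * ∑ k, C.conCurv G k l k
      = ∑ k, C.Y k (C.curv G k l) - C.Y l (∑ k, C.curv G k k) := by
    rw [Finset.mul_sum, map_sum, ← Finset.sum_sub_distrib]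
    exact Finset.sum_congr rfl fun k _ => (C.Y_curv_sub G k l k).symm
  have h2 := h.two_mul_sum_derivation_curv hK C.Y l
  have h3 := h.euler_scalar hK hn
  have h4 := h.euler_Y l
  rw [euler_apply] at h3 h4
  have h5 : C.Y l ((Fintype.card ι : A) - 1) = 0 := by
    rw [map_sub, Derivation.map_natCast, Derivation.map_one_eq_zero, sub_zero]
  rw [h3, h4, derivation_mul] at h2
  simp only [C.Y_y, if_true, Finset.sum_const, Finset.card_univ, nsmul_eq_mul, mul_one] at h2
  rw [h.trace_curv hK, derivation_mul, h5, derivation_mul] at h1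
  linear_combination 2 * h1 + h2

/-- The contracted Bianchi identity with the scalar form of R inserted. On the right-hand side all
terms containing undifferentiated K cancel. -/
theorem spray_trace_conCurv_scalar (l : ι) :
    2 * (C.spray G (∑ k, C.conCurv G k l k)
      - ∑ m, C.Y l (G m) * ∑ k, C.conCurv G k m k)
      = -(2 * ((Fintype.card ι : A) - 2) * L * C.hor G l K) - C.spray G K * C.Y l L := by
  have h1 := C.spray_trace_conCurv G l
  have h2 := h.two_mul_sum_derivation_curv hK (C.hor G) l
  rw [h.sum_y_mul_hor, h.sum_y_mul_hor, h.spray, derivation_mul, h.hor_self, mul_zero, add_zero]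
    at h2
  have h3 : ∑ k, C.hor G k (C.y k) = - ∑ k, C.Y k (G k) := by
    simp [hor_apply, C.X_y, C.Y_y]
  have h4 : 2 * ∑ k, ∑ m, C.curv G m l * C.Y m (C.Y k (G k))
      = K * (2 * L * (∑ k, C.Y l (C.Y k (G k))) - (∑ k, C.Y k (G k)) * C.Y l L) := by
    have e : ∀ k, ∑ m, C.y m * C.Y m (C.Y k (G k)) = C.Y k (G k) := by
      intro k
      rw [← euler_apply, h.euler_Y_geod]
    rw [Finset.mul_sum]
    simp only [h.two_mul_sum_curv_mul hK, e, ← Finset.mul_sum, Finset.sum_sub_distrib,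
      ← Finset.sum_mul]
  have h5 : 2 * ∑ k, ∑ m, C.curv G m k * C.Y m (C.Y l (G k))
      = K * (2 * L * (∑ k, C.Y l (C.Y k (G k))) - C.X l L) := by
    have e : ∀ k, ∑ m, C.y m * C.Y m (C.Y l (G k)) = C.Y l (G k) := by
      intro k
      rw [← euler_apply, h.euler_Y_geod]
    rw [Finset.mul_sum]
    simp only [h.two_mul_sum_curv_mul hK, e, ← Finset.mul_sum, Finset.sum_sub_distrib,
      C.YY l, ← h.X_self]
  have h6 : C.hor G l (∑ k, C.curv G k k)
      = ((Fintype.card ι : A) - 1) * (L * C.hor G l K) := by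
    rw [h.trace_curv hK, derivation_mul, derivation_mul _ K, h.hor_self, map_sub,
      Derivation.map_natCast, Derivation.map_one_eq_zero]
    ring
  rw [h3] at h2
  rw [h6] at h1
  linear_combination 2 * h1 + h2 + h4 - h5

/-- The two preceding formulas give the same derivative of the trace of Ω along S. `Y_spray`
replaces S(K_{·l}) by (SK)_{·l} - δₗK plus a connection term, and n - 2 factors out of the
comparison. -/
theorem eight_mul_hor_scalar (hn : 3 ≤ Fintype.card ι) (l : ι) :
    8 * (L * C.hor G l K) = 2 * (L * C.Y l (C.spray G K)) + 3 * (C.spray G K * C.Y l L) := by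
  have h1 := h.spray_trace_conCurv_scalar hK l
  have h2 := h.six_mul_trace_conCurv hK (le_trans (by norm_num) hn)
  have h3 := congrArg (C.spray G) (h2 l)
  have h4 : ∑ m, C.Y l (G m) * (6 * ∑ k, C.conCurv G k m k)
      = -(2 * ((Fintype.card ι : A) - 2) * L * ∑ m, C.Y l (G m) * C.Y m K)
        - 3 * ((Fintype.card ι : A) - 1) * K * C.X l L := by
    simp only [h2, mul_sub, mul_neg, Finset.sum_sub_distrib, Finset.sum_neg_distrib, h.X_self l,
      Finset.mul_sum]
    congr 1
    · congr 1
      exact Finset.sum_congr rfl fun m _ => by ring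
    · exact Finset.sum_congr rfl fun m _ => by ring
  have h5 : ∀ m : ℕ, C.spray G (m : A) = 0 := fun m => Derivation.map_natCast _ m
  have h6 : C.spray G 2 = 0 := by exact_mod_cast h5 2
  have h7 : C.spray G 3 = 0 := by exact_mod_cast h5 3
  have h8 : C.spray G 6 = 0 := by exact_mod_cast h5 6
  simp only [map_sub, map_neg, derivation_mul, h5, h6, h7, h8, h.spray_self, h.spray,
    Derivation.map_one_eq_zero] at h3
  have h9 := C.Y_spray G l K
  simp only [mul_left_comm _ (6 : A), ← Finset.mul_sum] at h4
  obtain ⟨m, hm⟩ := Nat.exists_eq_add_of_le hn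
  -- Here m + 1 = n - 2, a unit because n ≥ 3.
  have h10 : ((m + 1 : ℕ) : A) * (8 * (L * C.hor G l K) - (2 * (L * C.Y l (C.spray G K))
      + 3 * (C.spray G K * C.Y l L))) = 0 := by
    rw [hm] at h1 h3 h4
    push_cast at h1 h3 h4 ⊢
    linear_combination 3 * h1 - h3 + h4 - 2 * (1 + (m : A)) * L * h9
  exact sub_eq_zero.1 ((isUnit_natCast (Nat.succ_ne_zero m)).mul_right_eq_zero.1 h10)

theorem Y_hor_scalar_sub (hn : 3 ≤ Fintype.card ι) (i j : ι) :
    8 * L * (C.Y j (C.hor G i K) - C.Y i (C.hor G j K))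
      = 3 * (C.Y j (C.spray G K) * C.Y i L - C.Y i (C.spray G K) * C.Y j L) := by
  have h1 := h.eight_mul_hor_scalar hK hn
  have h0 : ∀ l : ι, C.Y l (2 : A) = 0 ∧ C.Y l (3 : A) = 0 ∧ C.Y l (8 : A) = 0 := fun l =>
    ⟨by exact_mod_cast Derivation.map_natCast (C.Y l) 2,
      by exact_mod_cast Derivation.map_natCast (C.Y l) 3,
      by exact_mod_cast Derivation.map_natCast (C.Y l) 8⟩
  have h2 := congrArg (C.Y j) (h1 i)
  have h3 := congrArg (C.Y i) (h1 j)
  simp only [map_add, derivation_mul, (h0 _).1, (h0 _).2.1, (h0 _).2.2, C.YY j i L,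
    C.YY j i (C.spray G K)] at h2 h3
  -- The extra factor L allows `h1` to eliminate the terms L_{·j} δᵢK produced by the product rule.
  refine h.isUnit.mul_left_cancel ?_
  linear_combination L * h2 - L * h3 - C.Y j L * h1 i + C.Y i L * h1 j

theorem cyclic_sum (hn : 3 ≤ Fintype.card ι) (i j k : ι) :
    (C.Y j (C.hor G i K) - C.Y i (C.hor G j K)) * C.Y k L
      + (C.Y i (C.hor G k K) - C.Y k (C.hor G i K)) * C.Y j L
      + (C.Y k (C.hor G j K) - C.Y j (C.hor G k K)) * C.Y i L = 0 := by
  have h1 := h.Y_hor_scalar_sub hK hn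
  have h8 : IsUnit (8 : A) := by exact_mod_cast isUnit_natCast (A := A) (m := 8) (by norm_num)
  refine (h8.mul h.isUnit).mul_right_eq_zero.1 ?_
  linear_combination C.Y k L * h1 i j + C.Y j L * h1 k i + C.Y i L * h1 j k

end Scalar
end IsEnergy
end Calculus
end Finsler

/-! ### Smooth functions on an open set as a model of the calculus -/

namespace Finsler
section SmoothFunctions

variable {V : Type*} [NormedAddCommGroup V] [NormedSpace ℝ V]

/-- The algebra of smooth functions on an open set. -/
def smoothFunctions (U : Set V) : Subalgebra ℝ (U → ℝ) where
  carrier := {f | ∃ g : V → ℝ, ContDiffOn ℝ ∞ g U ∧ ∀ p : U, g p = f p}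
  mul_mem' := by
    rintro f f' ⟨g, hg, e⟩ ⟨g', hg', e'⟩
    exact ⟨_, hg.mul hg', fun p => by simp [e, e']⟩
  add_mem' := by
    rintro f f' ⟨g, hg, e⟩ ⟨g', hg', e'⟩
    exact ⟨_, hg.add hg', fun p => by simp [e, e']⟩
  algebraMap_mem' r := ⟨fun _ => r, contDiffOn_const, fun p => rfl⟩

variable {U : Set V}

/-- `f` restricts to the smooth function `a` on `U`. -/
def Represents (f : V → ℝ) (a : smoothFunctions U) : Prop := ∀ p : U, f p = (a : U → ℝ) p

theorem exists_represents (a : smoothFunctions U) :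
    ∃ g : V → ℝ, ContDiffOn ℝ ∞ g U ∧ Represents g a := a.2

/-- The smooth function on `U` given by a function that is smooth on `U`. -/
def ofContDiffOn {f : V → ℝ} (hf : ContDiffOn ℝ ∞ f U) : smoothFunctions U :=
  ⟨fun p => f p, f, hf, fun _ => rfl⟩

theorem represents_ofContDiffOn {f : V → ℝ} (hf : ContDiffOn ℝ ∞ f U) :
    Represents f (ofContDiffOn hf) := fun _ => rfl

namespace Represents

variable {f g : V → ℝ} {a b : smoothFunctions U}

theorem contDiffOn (h : Represents f a) : ContDiffOn ℝ ∞ f U := by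
  obtain ⟨g, hg, e⟩ := exists_represents a
  exact hg.congr fun p hp => (h ⟨p, hp⟩).trans (e ⟨p, hp⟩).symm

theorem add (h : Represents f a) (h' : Represents g b) :
    Represents (fun p => f p + g p) (a + b) := fun p => by simp [h p, h' p]

theorem sub (h : Represents f a) (h' : Represents g b) :
    Represents (fun p => f p - g p) (a - b) := fun p => by simp [h p, h' p]

theorem mul (h : Represents f a) (h' : Represents g b) :
    Represents (fun p => f p * g p) (a * b) := fun p => by simp [h p, h' p]

theorem const (r : ℝ) : Represents (fun _ => r) (algebraMap ℝ (smoothFunctions U) r) :=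
  fun _ => rfl

theorem const_mul (r : ℝ) (h : Represents f a) : Represents (fun p => r * f p) (r • a) :=
  fun p => by simp [h p]

theorem sum {κ : Type*} {s : Finset κ} {f : κ → V → ℝ} {a : κ → smoothFunctions U}
    (h : ∀ i, Represents (f i) (a i)) :
    Represents (fun p => ∑ i ∈ s, f i p) (∑ i ∈ s, a i) := fun p => by
  simp [h _ p]

theorem fderiv_eq (hU : IsOpen U) (h : Represents f a) (h' : Represents g a) (p : U) :
    fderiv ℝ f p = fderiv ℝ g p := by
  refine Filter.EventuallyEq.fderiv_eq ?_
  filter_upwards [hU.mem_nhds p.2] with q hq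
  exact (h ⟨q, hq⟩).trans (h' ⟨q, hq⟩).symm

theorem differentiableAt (hU : IsOpen U) (h : Represents f a) (p : U) :
    DifferentiableAt ℝ f p :=
  (h.contDiffOn.contDiffAt (hU.mem_nhds p.2)).differentiableAt (by simp)

theorem contDiffOn_fderiv (hU : IsOpen U) (h : Represents f a) (v : V) :
    ContDiffOn ℝ ∞ (fun p => fderiv ℝ f p v) U :=
  (h.contDiffOn.fderiv_of_isOpen hU (by simp)).clm_apply contDiffOn_const

end Represents

/-- The directional derivative as a derivation of the algebra of smooth functions. -/
noncomputable def dirDeriv (hU : IsOpen U) (v : V) : Derivation ℝ (smoothFunctions U) (smoothFunctions U) :=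
  Derivation.mk'
    -- The chosen extension of `a` does not matter: `U` is open, so two extensions agree near each
    -- of its points.
    { toFun := fun a =>
        ofContDiffOn ((exists_represents a).choose_spec.2.contDiffOn_fderiv hU v)
      map_add' := by
        intro a b
        refine Subtype.ext (funext fun p => ?_)
        have ha := (exists_represents a).choose_spec.2
        have hb := (exists_represents b).choose_spec.2
        change fderiv ℝ (exists_represents (a + b)).choose p v
          = fderiv ℝ (exists_represents a).choose p v + fderiv ℝ (exists_represents b).choose p v
        rw [Represents.fderiv_eq hU (exists_represents (a + b)).choose_spec.2 (ha.add hb),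
          fderiv_fun_add (ha.differentiableAt hU p) (hb.differentiableAt hU p)]
        rfl
      map_smul' := by
        intro r a
        refine Subtype.ext (funext fun p => ?_)
        have ha := (exists_represents a).choose_spec.2
        change fderiv ℝ (exists_represents (r • a)).choose p v
          = r * fderiv ℝ (exists_represents a).choose p v
        rw [Represents.fderiv_eq hU (exists_represents (r • a)).choose_spec.2 (ha.const_mul r),
          fderiv_const_mul (ha.differentiableAt hU p)]
        rfl }
    (by
      intro a b
      refine Subtype.ext (funext fun p => ?_)
      have ha := (exists_represents a).choose_spec.2
      have hb := (exists_represents b).choose_spec.2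
      change fderiv ℝ (exists_represents (a * b)).choose p v
        = (a : U → ℝ) p * fderiv ℝ (exists_represents b).choose p v
          + (b : U → ℝ) p * fderiv ℝ (exists_represents a).choose p v
      rw [Represents.fderiv_eq hU (exists_represents (a * b)).choose_spec.2 (ha.mul hb),
        fderiv_fun_mul (ha.differentiableAt hU p) (hb.differentiableAt hU p), ← ha p, ← hb p]
      rfl)

theorem Represents.dirDeriv {f : V → ℝ} {a : smoothFunctions U} (h : Represents f a)
    (hU : IsOpen U) (v : V) : Represents (fun p => fderiv ℝ f p v) (dirDeriv hU v a) := by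
  intro p
  change fderiv ℝ f p v = fderiv ℝ (exists_represents a).choose p v
  rw [Represents.fderiv_eq hU h (exists_represents a).choose_spec.2]

theorem dirDeriv_comm (hU : IsOpen U) (v w : V) (a : smoothFunctions U) :
    dirDeriv hU v (dirDeriv hU w a) = dirDeriv hU w (dirDeriv hU v a) := by
  obtain ⟨f, hf, ha⟩ := exists_represents a
  refine Subtype.ext (funext fun p => ?_)
  rw [← (ha.dirDeriv hU w).dirDeriv hU v p, ← (ha.dirDeriv hU v).dirDeriv hU w p]
  have hc := hf.contDiffAt (hU.mem_nhds p.2)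
  have hd : DifferentiableAt ℝ (fderiv ℝ f) p :=
    (hc.fderiv_right (m := 1) (by norm_cast)).differentiableAt (by simp)
  have e : ∀ w v, fderiv ℝ (fun p => fderiv ℝ f p w) p v = fderiv ℝ (fderiv ℝ f) p v w := by
    intro w v
    rw [fderiv_clm_apply hd (differentiableAt_const w)]
    simp
  simp only [e]
  exact hc.isSymmSndFDerivAt (by simp only [minSmoothness_of_isRCLikeNormedField]; norm_cast) v w

theorem isUnit_of_ne_zero {a : smoothFunctions U} (h : ∀ p, (a : U → ℝ) p ≠ 0) : IsUnit a := by
  obtain ⟨f, hf, ha⟩ := exists_represents a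
  have h' : ContDiffOn ℝ ∞ (fun p => (f p)⁻¹) U :=
    hf.inv fun p hp => by rw [ha ⟨p, hp⟩]; exact h _
  refine IsUnit.of_mul_eq_one (ofContDiffOn h') (Subtype.ext (funext fun p => ?_))
  change (a : U → ℝ) p * (f p)⁻¹ = 1
  rw [ha p, mul_inv_cancel₀ (h p)]

/-- Evaluation at a point. -/
def evalAt (p : U) : smoothFunctions U →ₐ[ℝ] ℝ :=
  (Pi.evalAlgHom ℝ (fun _ : U => ℝ) p).comp (smoothFunctions U).val

theorem ext_evalAt {a b : smoothFunctions U} (h : ∀ p, evalAt p a = evalAt p b) : a = b :=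
  Subtype.ext (funext h)

theorem Represents.evalAt {f : V → ℝ} {a : smoothFunctions U} (h : Represents f a) (p : U) :
    evalAt p a = f p := (h p).symm

end SmoothFunctions

section Coordinates

variable {n : ℕ} {U : Set (E n × E n)}

/-- The coordinate calculus on an open set of `(x, y)`-space. -/
noncomputable def coordCalculus (hU : IsOpen U) : Calculus (Fin n) (smoothFunctions U) where
  X i := dirDeriv hU (basisVec i, 0)
  Y i := dirDeriv hU (0, basisVec i)
  y i := ofContDiffOn (f := fun p => p.2 i) (by fun_prop)
  XX _ _ _ := dirDeriv_comm hU _ _ _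
  YX _ _ _ := dirDeriv_comm hU _ _ _
  YY _ _ _ := dirDeriv_comm hU _ _ _
  X_y i j := by
    refine ext_evalAt fun p => ?_
    rw [((represents_ofContDiffOn _).dirDeriv hU _).evalAt p]
    have : HasFDerivAt (fun p : E n × E n => p.2 j)
      ((EuclideanSpace.proj j).comp (ContinuousLinearMap.snd ℝ (E n) (E n))) (p : E n × E n) :=
      ((EuclideanSpace.proj j).comp (ContinuousLinearMap.snd ℝ (E n) (E n))).hasFDerivAt
    rw [this.fderiv]
    simp
  Y_y i j := by
    refine ext_evalAt fun p => ?_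
    rw [((represents_ofContDiffOn _).dirDeriv hU _).evalAt p]
    have : HasFDerivAt (fun p : E n × E n => p.2 j)
      ((EuclideanSpace.proj j).comp (ContinuousLinearMap.snd ℝ (E n) (E n))) (p : E n × E n) :=
      ((EuclideanSpace.proj j).comp (ContinuousLinearMap.snd ℝ (E n) (E n))).hasFDerivAt
    rw [this.fderiv]
    by_cases h : i = j
    · simp [basisVec, h]
    · simp [basisVec, h, Ne.symm h]

variable {f : E n × E n → ℝ} {a : smoothFunctions U}

theorem Represents.dx (h : Represents f a) (hU : IsOpen U) (i : Fin n) :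
    Represents (dx i f) ((coordCalculus hU).X i a) := h.dirDeriv hU _

theorem Represents.dy (h : Represents f a) (hU : IsOpen U) (i : Fin n) :
    Represents (dy i f) ((coordCalculus hU).Y i a) := h.dirDeriv hU _

theorem represents_y (hU : IsOpen U) (i : Fin n) :
    Represents (fun p : E n × E n => p.2 i) ((coordCalculus hU).y i) := fun _ => rfl

theorem Represents.hor {F : E n × E n → ℝ} {G : Fin n → smoothFunctions U}
    (hG : ∀ i, Represents (geodCoeff F i) (G i)) (h : Represents f a) (hU : IsOpen U)
    (i : Fin n) : Represents (horDeriv F i f) ((coordCalculus hU).hor G i a) := by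
  rw [Calculus.hor_apply]
  exact (h.dx hU i).sub (Represents.sum fun m => ((hG m).dy hU i).mul (h.dy hU m))

theorem represents_riemannCurv {F : E n × E n → ℝ} {G : Fin n → smoothFunctions U}
    (hG : ∀ i, Represents (geodCoeff F i) (G i)) (hU : IsOpen U) (i k : Fin n) :
    Represents (riemannCurv F i k) ((coordCalculus hU).curv G i k) := by
  have h2 : (2 : smoothFunctions U) = algebraMap ℝ _ 2 := (map_ofNat _ 2).symm
  rw [Calculus.curv, h2]
  exact ((((Represents.const 2).mul ((hG i).dx hU k)).sub
    (Represents.sum fun l => (((hG i).dy hU k).dx hU l).mul (represents_y hU l))).add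
    ((Represents.const 2).mul (Represents.sum fun l => (hG l).mul (((hG i).dy hU k).dy hU l)))).sub
    (Represents.sum fun l => ((hG i).dy hU l).mul ((hG l).dy hU k))

/-- Commuting ∂/∂yʲ past δᵢ produces exactly the Berwald coefficients, so K_{·j|i} = ∂/∂yʲ (δᵢK). -/
theorem represents_vertHor {F K : E n × E n → ℝ} {G : Fin n → smoothFunctions U}
    (hG : ∀ i, Represents (geodCoeff F i) (G i)) (hK : Represents K a) (hU : IsOpen U)
    (j i : Fin n) :
    Represents (vertHor F K j i)
      ((coordCalculus hU).Y j ((coordCalculus hU).hor G i a)) := by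
  rw [Calculus.Y_hor]
  refine ((hK.dy hU j).hor hG hU i).sub (Represents.sum fun m => ?_)
  rw [Calculus.YY]
  exact (((hG m).dy hU j).dy hU i).mul (hK.dy hU m)

end Coordinates
end Finsler

/-! ### Finsler metrics in a chart: smoothness, nonvanishing, homogeneity -/

namespace Finsler
section Chart

variable {n : ℕ} {M : Type*} [TopologicalSpace M] [ChartedSpace (E n) M]
  {φ : OpenPartialHomeomorph M (E n)}

theorem mfderiv_symm_ne_zero (hφ : φ ∈ IsManifold.maximalAtlas (𝓡 n) ∞ M) {x : E n}
    (hx : x ∈ φ.target) {y : E n} (hy : y ≠ 0) : mfderiv (𝓡 n) (𝓡 n) φ.symm x y ≠ 0 := by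
  have hd : φ.MDifferentiable (𝓡 n) (𝓡 n) :=
    ⟨(contMDiffOn_of_mem_maximalAtlas hφ).mdifferentiableOn (by simp),
      (contMDiffOn_symm_of_mem_maximalAtlas hφ).mdifferentiableOn (by simp)⟩
  intro h
  exact hy (hd.symm.mfderiv_injective hx (h.trans (map_zero _).symm))

theorem contMDiff_mk_tangentBundle :
    ContMDiff 𝓘(ℝ, E n × E n) (𝓡 n).tangent ∞
      (fun p : E n × E n => (⟨p.1, p.2⟩ : TangentBundle (𝓡 n) (E n))) := by
  have h := contMDiff_tangentBundleModelSpaceHomeomorph_symm (I := 𝓡 n) (n := ∞)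
  rw [modelWithCornersSelf_prod]
  exact h

variable [IsManifold (𝓡 n) ∞ M] {F : TangentBundle (𝓡 n) M → ℝ}

theorem contDiffOn_coordRep (hF : IsFinslerMetric F)
    (hφ : φ ∈ IsManifold.maximalAtlas (𝓡 n) ∞ M) :
    ContDiffOn ℝ ∞ (coordRep φ F) (φ.target ×ˢ {0}ᶜ) := by
  have h1 : ContMDiffOn (𝓡 n).tangent (𝓡 n).tangent ∞
      (tangentMapWithin (𝓡 n) (𝓡 n) φ.symm φ.target)
      (Bundle.TotalSpace.proj ⁻¹' φ.target) :=
    (contMDiffOn_symm_of_mem_maximalAtlas hφ).contMDiffOn_tangentMapWithin (by simp)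
      φ.open_target.uniqueMDiffOn
  have h2 : ContMDiffOn 𝓘(ℝ, E n × E n) (𝓡 n).tangent ∞
      (fun p : E n × E n => tangentMapWithin (𝓡 n) (𝓡 n) φ.symm φ.target ⟨p.1, p.2⟩)
      (φ.target ×ˢ {0}ᶜ) :=
    h1.comp contMDiff_mk_tangentBundle.contMDiffOn fun p hp => hp.1
  have h3 : ∀ p ∈ φ.target ×ˢ ({0}ᶜ : Set (E n)),
      tangentMapWithin (𝓡 n) (𝓡 n) φ.symm φ.target ⟨p.1, p.2⟩
        = ⟨φ.symm p.1, mfderiv (𝓡 n) (𝓡 n) φ.symm p.1 p.2⟩ := by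
    intro p hp
    rw [tangentMapWithin, mfderivWithin_of_isOpen φ.open_target hp.1]
  rw [← contMDiffOn_iff_contDiffOn]
  refine (hF.smooth.comp h2 fun p hp => ?_).congr fun p hp => ?_
  · rw [Set.mem_preimage, h3 p hp]
    exact mfderiv_symm_ne_zero hφ hp.1 hp.2
  · rw [Function.comp_apply, h3 p hp]
    rfl

theorem coordRep_ne_zero (hF : IsFinslerMetric F) (hφ : φ ∈ IsManifold.maximalAtlas (𝓡 n) ∞ M)
    {p : E n × E n} (hp : p ∈ φ.target ×ˢ ({0}ᶜ : Set (E n))) : coordRep φ F p ≠ 0 := fun h =>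
  mfderiv_symm_ne_zero hφ hp.1 hp.2 ((hF.eq_zero_iff _).1 h)

theorem coordRep_smul (hF : IsFinslerMetric F) (x y : E n) {c : ℝ} (hc : 0 ≤ c) :
    coordRep φ F (x, c • y) = c * coordRep φ F (x, y) := by
  rw [coordRep, coordRep, ← hF.homogeneous _ _ c hc]
  exact congrArg (fun v => F ⟨φ.symm x, v⟩)
    (ContinuousLinearMap.map_smul (mfderiv (𝓡 n) (𝓡 n) φ.symm x) c y)

end Chart
end Finsler

/-! ### Polarization of the flag curvature condition -/

namespace Finsler
section Polarization

open Matrix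

variable {n : ℕ} {g R : Matrix (Fin n) (Fin n) ℝ} {y : Fin n → ℝ}

theorem dotProduct_mulVec_comm_of_isHermitian (hg : g.IsHermitian) (u v : Fin n → ℝ) :
    u ⬝ᵥ g *ᵥ v = v ⬝ᵥ g *ᵥ u := by
  have h : gᵀ = g := by simpa [Matrix.IsHermitian, conjTranspose_eq_transpose_of_trivial] using hg
  rw [dotProduct_mulVec, ← mulVec_transpose, h, dotProduct_comm]

/-- For v = g(y,y) u - g(y,u) y, nonzero by independence, g(v,v) is g(y,y) times the Gram
determinant. -/
theorem gram_pos (hg : g.PosDef) (hy : y ≠ 0) {u : Fin n → ℝ} (hu : ∀ c : ℝ, c • y ≠ u) :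
    0 < (y ⬝ᵥ g *ᵥ y) * (u ⬝ᵥ g *ᵥ u) - (y ⬝ᵥ g *ᵥ u) ^ 2 := by
  have h1 : 0 < y ⬝ᵥ g *ᵥ y := by simpa using hg.dotProduct_mulVec_pos hy
  have hv : (y ⬝ᵥ g *ᵥ y) • u - (y ⬝ᵥ g *ᵥ u) • y ≠ 0 := by
    intro h
    refine hu ((y ⬝ᵥ g *ᵥ y)⁻¹ * (y ⬝ᵥ g *ᵥ u)) ?_
    rw [mul_smul, ← sub_eq_zero.1 h, inv_smul_smul₀ h1.ne']
  have h2 := hg.dotProduct_mulVec_pos hv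
  have h3 := dotProduct_mulVec_comm_of_isHermitian hg.isHermitian u y
  simp only [star_trivial, mulVec_sub, mulVec_smul, dotProduct_sub, sub_dotProduct,
    dotProduct_smul, smul_dotProduct, smul_eq_mul, h3] at h2
  refine pos_of_mul_pos_right (a := y ⬝ᵥ g *ᵥ y) ?_ h1.le
  linarith

theorem add_transpose_eq_zero_of_quadratic {N : Matrix (Fin n) (Fin n) ℝ}
    (h : ∀ u : Fin n → ℝ, u ⬝ᵥ N *ᵥ u = 0) (i j : Fin n) : N i j + N j i = 0 := by
  have h1 := h (Pi.single i 1)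
  have h2 := h (Pi.single j 1)
  have h3 := h (Pi.single i 1 + Pi.single j 1)
  simp only [mulVec_add, dotProduct_add, add_dotProduct, mulVec_single_one,
    single_one_dotProduct] at h1 h2 h3
  simp only [col_apply] at h1 h2 h3
  linarith

/-- The hypothesis is an equality of quadratic forms off the line spanned by y. On that line both
sides vanish because R y = 0, so the equality holds everywhere and polarizes. -/
theorem symmetrized_curv_eq (hg : g.PosDef) (hy : y ≠ 0) (hR : R *ᵥ y = 0) {K : ℝ}
    (hK : ∀ u : Fin n → ℝ, (∀ c : ℝ, c • y ≠ u) → (u ⬝ᵥ (g * R) *ᵥ u)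
      / ((y ⬝ᵥ g *ᵥ y) * (u ⬝ᵥ g *ᵥ u) - (y ⬝ᵥ g *ᵥ u) ^ 2) = K) (i j : Fin n) :
    (g * R) i j + (g * R) j i
      = 2 * K * ((y ⬝ᵥ g *ᵥ y) * g i j - (g *ᵥ y) i * (g *ᵥ y) j) := by
  have hq : ∀ u : Fin n → ℝ,
      u ⬝ᵥ (g * R - K • ((y ⬝ᵥ g *ᵥ y) • g - vecMulVec (g *ᵥ y) (g *ᵥ y))) *ᵥ u = 0 := by
    intro u
    have e : u ⬝ᵥ (g * R - K • ((y ⬝ᵥ g *ᵥ y) • g - vecMulVec (g *ᵥ y) (g *ᵥ y))) *ᵥ u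
        = u ⬝ᵥ (g * R) *ᵥ u
          - K * ((y ⬝ᵥ g *ᵥ y) * (u ⬝ᵥ g *ᵥ u) - (y ⬝ᵥ g *ᵥ u) ^ 2) := by
      have h3 := dotProduct_mulVec_comm_of_isHermitian hg.isHermitian y u
      simp only [sub_mulVec, smul_mulVec, dotProduct_sub, dotProduct_smul, smul_eq_mul,
        vecMulVec_mulVec, op_smul_eq_smul, dotProduct_comm (g *ᵥ y) u, h3]
      ring
    rw [e]
    by_cases hu : ∃ c : ℝ, c • y = u
    · obtain ⟨c, rfl⟩ := hu
      simp only [← mulVec_mulVec, mulVec_smul, hR, smul_zero, mulVec_zero, dotProduct_zero,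
        dotProduct_smul, smul_dotProduct, smul_eq_mul]
      ring
    · push Not at hu
      have := (div_eq_iff (gram_pos hg hy hu).ne').1 (hK u hu)
      linarith
  have h := add_transpose_eq_zero_of_quadratic hq i j
  have hs : g j i = g i j := by simpa using hg.isHermitian.apply i j
  simp only [Matrix.sub_apply, Matrix.smul_apply, vecMulVec_apply, smul_eq_mul, hs] at h
  linarith

theorem gram_ne_zero (hg : g.PosDef) (hy : y ≠ 0) (hn : 2 ≤ n) :
    ∃ i j, (y ⬝ᵥ g *ᵥ y) * g i j - (g *ᵥ y) i * (g *ᵥ y) j ≠ 0 := by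
  by_contra! hc
  obtain ⟨u, hu⟩ : ∃ u : Fin n → ℝ, ∀ c : ℝ, c • y ≠ u := by
    by_contra! h
    have := finrank_le_one y h
    rw [Module.finrank_fin_fun] at this
    omega
  have h1 := gram_pos hg hy hu
  have h2 : (y ⬝ᵥ g *ᵥ y) • g - vecMulVec (g *ᵥ y) (g *ᵥ y) = 0 := by
    ext i j
    simpa [vecMulVec_apply] using hc i j
  have h3 : u ⬝ᵥ ((y ⬝ᵥ g *ᵥ y) • g - vecMulVec (g *ᵥ y) (g *ᵥ y)) *ᵥ u
      = (y ⬝ᵥ g *ᵥ y) * (u ⬝ᵥ g *ᵥ u) - (y ⬝ᵥ g *ᵥ u) ^ 2 := by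
    have h3 := dotProduct_mulVec_comm_of_isHermitian hg.isHermitian y u
    simp only [sub_mulVec, smul_mulVec, dotProduct_sub, dotProduct_smul, smul_eq_mul,
      vecMulVec_mulVec, op_smul_eq_smul, dotProduct_comm (g *ᵥ y) u, h3]
    ring
  rw [h2] at h3
  simp only [zero_mulVec, dotProduct_zero] at h3
  linarith

end Polarization

/-! ### From a Finsler function in coordinates to the energy axioms -/

section LocalFinsler

open Matrix

variable {n : ℕ} {U : Set (E n × E n)} {F : E n × E n → ℝ}

theorem sum_dy_mul_eq (f : E n × E n → ℝ) (p : E n × E n) :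
    ∑ i, p.2 i * dy i f p = fderiv ℝ f p (0, p.2) := by
  have h : p.2 = ∑ i, p.2 i • basisVec i := by
    simpa [basisVec] using ((EuclideanSpace.basisFun (Fin n) ℝ).sum_repr p.2).symm
  have h2 : ((0, p.2) : E n × E n) = ∑ i, p.2 i • ((0, basisVec i) : E n × E n) := by
    refine Prod.ext ?_ ?_
    · simp [Prod.fst_sum]
    · simpa [Prod.snd_sum] using h
  rw [h2, map_sum]
  exact Finset.sum_congr rfl fun i _ => by rw [map_smul, smul_eq_mul, dy]

theorem fderiv_self_of_homogeneous {f : E n × E n → ℝ} {x y : E n}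
    (hf : DifferentiableAt ℝ f (x, y)) (h : ∀ c : ℝ, 0 ≤ c → f (x, c • y) = c * f (x, y)) :
    fderiv ℝ f (x, y) (0, y) = f (x, y) := by
  have h1 : HasDerivAt (fun c : ℝ => (x, c • y)) ((0 : E n), y) 1 := by
    simpa using (hasDerivAt_const (1 : ℝ) x).prodMk ((hasDerivAt_id (1 : ℝ)).smul_const y)
  -- Euler's relation: differentiate f(x, cy) = c f(x, y) at c = 1.
  have h2 : HasDerivAt (fun c : ℝ => f (x, c • y)) (fderiv ℝ f (x, y) (0, y)) 1 :=
    HasFDerivAt.comp_hasDerivAt (f := fun c : ℝ => (x, c • y)) 1 (by simpa using hf.hasFDerivAt) h1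
  have h3 : HasDerivAt (fun c : ℝ => c * f (x, y)) (f (x, y)) 1 := by
    simpa using (hasDerivAt_id (1 : ℝ)).mul_const (f (x, y))
  refine h2.unique (h3.congr_of_eventuallyEq ?_)
  filter_upwards [lt_mem_nhds (zero_lt_one (α := ℝ))] with c hc using h c hc.le

/-- The fundamental tensor with entries in the algebra of smooth functions. -/
noncomputable def smoothFundTensor (hU : IsOpen U) (L : smoothFunctions U) :
    Matrix (Fin n) (Fin n) (smoothFunctions U) :=
  Matrix.of fun i j => (1 / 2 : ℝ) • (coordCalculus hU).Y j ((coordCalculus hU).Y i L)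

/-- The geodesic coefficients as elements of the algebra of smooth functions. -/
noncomputable def smoothGeodCoeff (hU : IsOpen U) (L : smoothFunctions U) (i : Fin n) :
    smoothFunctions U :=
  (1 / 4 : ℝ) • ∑ l, (smoothFundTensor hU L)⁻¹ i l *
    ((∑ m, (coordCalculus hU).X m ((coordCalculus hU).Y l L) * (coordCalculus hU).y m)
      - (coordCalculus hU).X l L)

variable {L : smoothFunctions U}

theorem map_smoothFundTensor (hU : IsOpen U) (hL : Represents (fun q => F q ^ 2) L) (p : U) :
    (smoothFundTensor hU L).map (evalAt p) = fundTensor F p := by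
  ext i j
  simp only [smoothFundTensor, fundTensor, map_apply, of_apply, map_smul, smul_eq_mul]
  rw [((hL.dy hU i).dy hU j).evalAt p]

theorem isUnit_det_smoothFundTensor (hU : IsOpen U) (hL : Represents (fun q => F q ^ 2) L)
    (hpd : ∀ p ∈ U, (fundTensor F p).PosDef) : IsUnit (smoothFundTensor hU L).det := by
  refine isUnit_of_ne_zero fun p => ?_
  have h : evalAt p (smoothFundTensor hU L).det = (fundTensor F p).det := by
    rw [AlgHom.map_det, ← map_smoothFundTensor hU hL p]
    rfl
  exact fun h0 => (hpd p p.2).det_pos.ne' (h.symm.trans h0)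

theorem represents_geodCoeff (hU : IsOpen U) (hL : Represents (fun q => F q ^ 2) L)
    (hpd : ∀ p ∈ U, (fundTensor F p).PosDef) (i : Fin n) :
    Represents (geodCoeff F i) (smoothGeodCoeff hU L i) := by
  have hinv : ∀ l, Represents (fun p => (fundTensor F p)⁻¹ i l)
      ((smoothFundTensor hU L)⁻¹ i l) := by
    intro l p
    have h : (fundTensor F p)⁻¹ = ((smoothFundTensor hU L)⁻¹).map (evalAt p) := by
      refine Matrix.inv_eq_right_inv ?_
      rw [← map_smoothFundTensor hU hL p, ← Matrix.map_mul,
        Matrix.mul_nonsing_inv _ (isUnit_det_smoothFundTensor hU hL hpd)]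
      exact Matrix.map_one _ (map_zero _) (map_one _)
    simp only [h]
    rfl
  exact Represents.const_mul _ (Represents.sum fun l => (hinv l).mul
    ((Represents.sum fun m => ((hL.dy hU l).dx hU m).mul (represents_y hU m)).sub (hL.dx hU l)))

theorem isEnergy_of_finsler (hU : IsOpen U) (hL : Represents (fun q => F q ^ 2) L)
    (hpd : ∀ p ∈ U, (fundTensor F p).PosDef) (hF : ∀ p ∈ U, F p ≠ 0)
    (hEuler : ∀ p ∈ U, fderiv ℝ (fun q => F q ^ 2) p (0, p.2) = 2 * F p ^ 2) :
    (coordCalculus hU).IsEnergy L (smoothGeodCoeff hU L) := by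
  have hdet := isUnit_det_smoothFundTensor hU hL hpd
  have hY : ∀ i j, (coordCalculus hU).Y j ((coordCalculus hU).Y i L)
      = (2 : ℝ) • smoothFundTensor hU L i j := by
    intro i j
    simp [smoothFundTensor, smul_smul]
  refine ⟨isUnit_of_ne_zero fun p => ?_, ext_evalAt fun p => ?_, fun l => ?_, fun v hv => ?_⟩
  · rw [← hL p]
    exact pow_ne_zero 2 (hF p p.2)
  · rw [Calculus.euler_apply, map_sum, map_mul, map_ofNat, hL.evalAt p, ← hEuler p p.2,
      ← sum_dy_mul_eq]
    refine Finset.sum_congr rfl fun i _ => ?_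
    rw [map_mul, (represents_y hU i).evalAt p, (hL.dy hU i).evalAt p]
  · set C := coordCalculus hU
    set w : Fin n → smoothFunctions U := fun l => (∑ m, C.X m (C.Y l L) * C.y m) - C.X l L with hw
    have h1 : smoothGeodCoeff hU L = (1 / 4 : ℝ) • ((smoothFundTensor hU L)⁻¹ *ᵥ w) := rfl
    have h2 : smoothFundTensor hU L *ᵥ smoothGeodCoeff hU L = (1 / 4 : ℝ) • w := by
      rw [h1, mulVec_smul, mulVec_mulVec, Matrix.mul_nonsing_inv _ hdet, one_mulVec]
    -- The Hessian of L is 2g, so 2 · 2 · ¼ = 1: the defining formula of Gⁱ becomes the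
    -- Euler–Lagrange equation.
    have h3 : 2 * ∑ i, smoothGeodCoeff hU L i * C.Y i (C.Y l L) = w l := by
      have h4 := congrArg (fun z => (4 : ℝ) • z) (congrFun h2 l)
      simp only [mulVec, dotProduct, Pi.smul_apply, smul_smul] at h4
      norm_num at h4
      rw [← h4, Finset.mul_sum, Finset.smul_sum]
      refine Finset.sum_congr rfl fun i _ => ?_
      have e4 : (4 : ℝ) = 2 * 2 := by norm_num
      rw [hY, e4, ← smul_smul, two_smul ℝ (2 • _ : smoothFunctions U)]
      simp only [two_smul]
      ring
    rw [Calculus.spray_apply, h3, hw]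
    simp only [mul_comm (C.y _)]
    ring
  · have h1 : smoothFundTensor hU L *ᵥ v = 0 := by
      funext l
      have h2 : (2 : ℝ) • (smoothFundTensor hU L *ᵥ v) l = 0 := by
        rw [← hv l, mulVec, dotProduct, Finset.smul_sum]
        refine Finset.sum_congr rfl fun i _ => ?_
        rw [(coordCalculus hU).YY, hY, smul_mul_assoc]
      simpa using h2
    have h2 : v = 0 := by
      rw [← one_mulVec v, ← Matrix.nonsing_inv_mul _ hdet, ← mulVec_mulVec, h1, mulVec_zero]
    exact congrFun h2

end LocalFinsler
end Finsler

/-! ### Smoothness of K and transfer of the cyclic identity -/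

namespace Finsler
section LocalFinsler

open Matrix

variable {n : ℕ} {U : Set (E n × E n)} {F K : E n × E n → ℝ} {L : smoothFunctions U}

theorem flagCurv_eq_div {p : E n × E n} (hg : (fundTensor F p).IsHermitian)
    (hL : p.2.ofLp ⬝ᵥ fundTensor F p *ᵥ p.2.ofLp = F p ^ 2) (u : E n) :
    flagCurv F p u = (u.ofLp ⬝ᵥ (fundTensor F p * of fun i k => riemannCurv F i k p) *ᵥ u.ofLp)
      / ((p.2.ofLp ⬝ᵥ fundTensor F p *ᵥ p.2.ofLp) * (u.ofLp ⬝ᵥ fundTensor F p *ᵥ u.ofLp)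
        - (p.2.ofLp ⬝ᵥ fundTensor F p *ᵥ u.ofLp) ^ 2) := by
  have hs : ∀ i j, fundTensor F p i j = fundTensor F p j i := fun i j => by
    simpa using hg.apply j i
  rw [hL, flagCurv]
  congr 1
  · rw [Finset.sum_comm]
    simp only [dotProduct, mulVec, Matrix.mul_apply, of_apply, Finset.mul_sum, Finset.sum_mul]
    refine Finset.sum_congr rfl fun m _ => ?_
    rw [Finset.sum_comm]
    refine Finset.sum_congr rfl fun k _ => Finset.sum_congr rfl fun i _ => ?_
    rw [hs i m]
    ring
  · simp only [dotProduct, mulVec, Finset.mul_sum]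
    congr 2
    · funext i
      exact Finset.sum_congr rfl fun j _ => by ring
    · congr 1
      funext i
      exact Finset.sum_congr rfl fun j _ => by ring

/-- The symmetrized form of `2 g_{im} Rⁱₖ`. -/
noncomputable def symCurv (hU : IsOpen U) (L : smoothFunctions U) (m k : Fin n) :
    smoothFunctions U :=
  ∑ i, (coordCalculus hU).Y m ((coordCalculus hU).Y i L)
      * (coordCalculus hU).curv (smoothGeodCoeff hU L) i k
    + ∑ i, (coordCalculus hU).Y k ((coordCalculus hU).Y i L)
      * (coordCalculus hU).curv (smoothGeodCoeff hU L) i m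

/-- Four times the Gram form `F² g_{mk} - g_{im} yⁱ g_{jk} yʲ`. -/
noncomputable def gramForm (hU : IsOpen U) (L : smoothFunctions U) (m k : Fin n) :
    smoothFunctions U :=
  2 * L * (coordCalculus hU).Y m ((coordCalculus hU).Y k L)
    - (coordCalculus hU).Y m L * (coordCalculus hU).Y k L

variable (hU : IsOpen U) (hL : Represents (fun q => F q ^ 2) L)
  (hpd : ∀ p ∈ U, (fundTensor F p).PosDef)
  (hE : (coordCalculus hU).IsEnergy L (smoothGeodCoeff hU L))
include hL hpd

theorem evalAt_Y_Y (p : U) (m i : Fin n) :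
    evalAt p ((coordCalculus hU).Y m ((coordCalculus hU).Y i L)) = 2 * fundTensor F p m i := by
  rw [((hL.dy hU i).dy hU m).evalAt p, ← (hpd p p.2).isHermitian.apply m i]
  simp [fundTensor]

include hE

theorem evalAt_Y (p : U) (m : Fin n) :
    evalAt p ((coordCalculus hU).Y m L)
      = 2 * (fundTensor F p *ᵥ (p : E n × E n).2.ofLp) m := by
  rw [← hE.sum_hessian_mul_y m, map_sum, mulVec, dotProduct, Finset.mul_sum]
  refine Finset.sum_congr rfl fun i _ => ?_
  rw [map_mul, evalAt_Y_Y hU hL hpd, (represents_y hU i).evalAt p, mul_assoc]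

theorem dotProduct_fundTensor_self (p : U) :
    (p : E n × E n).2.ofLp ⬝ᵥ fundTensor F p *ᵥ (p : E n × E n).2.ofLp = F p ^ 2 := by
  have h := congrArg (evalAt p) hE.euler
  rw [Calculus.euler_apply, map_sum, map_mul, map_ofNat, hL.evalAt p] at h
  have e : ∀ i, evalAt p ((coordCalculus hU).y i * (coordCalculus hU).Y i L)
      = 2 * ((p : E n × E n).2 i * (fundTensor F p *ᵥ (p : E n × E n).2.ofLp) i) := by
    intro i
    rw [map_mul, evalAt_Y hU hL hpd hE, (represents_y hU i).evalAt p]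
    ring
  simp only [e, ← Finset.mul_sum] at h
  exact mul_left_cancel₀ two_ne_zero h

theorem evalAt_gramForm (p : U) (m k : Fin n) :
    evalAt p (gramForm hU L m k)
      = 4 * ((((p : E n × E n).2.ofLp ⬝ᵥ fundTensor F p *ᵥ (p : E n × E n).2.ofLp))
        * fundTensor F p m k - (fundTensor F p *ᵥ (p : E n × E n).2.ofLp) m
          * (fundTensor F p *ᵥ (p : E n × E n).2.ofLp) k) := by
  rw [gramForm, map_sub, map_mul, map_mul, map_mul, map_ofNat, evalAt_Y hU hL hpd hE,
    evalAt_Y hU hL hpd hE, evalAt_Y_Y hU hL hpd, hL.evalAt p,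
    dotProduct_fundTensor_self hU hL hpd hE]
  ring

theorem evalAt_symCurv (hy : ∀ p ∈ U, p.2 ≠ 0)
    (hK : ∀ p ∈ U, ∀ u : E n, LinearIndependent ℝ ![p.2, u] → flagCurv F p u = K p)
    (p : U) (m k : Fin n) :
    evalAt p (symCurv hU L m k) = K p * evalAt p (gramForm hU L m k) := by
  have hg := hpd p p.2
  have hR : ∀ i k, evalAt p ((coordCalculus hU).curv (smoothGeodCoeff hU L) i k)
      = riemannCurv F i k p := fun i k =>
    (represents_riemannCurv (represents_geodCoeff hU hL hpd) hU i k).evalAt p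
  have hy' : (p : E n × E n).2.ofLp ≠ 0 := fun h0 => hy p p.2 (by ext i; simp [h0])
  have hRy : (of fun i k => riemannCurv F i k p) *ᵥ (p : E n × E n).2.ofLp = 0 := by
    funext i
    have h := congrArg (evalAt p) (hE.curv_mul_y i)
    simp only [map_sum, map_mul, hR, (represents_y hU _).evalAt p, map_zero] at h
    exact h
  have h := symmetrized_curv_eq hg hy' hRy (K := K p) (fun u hu => ?_) m k
  · rw [evalAt_gramForm hU hL hpd hE, symCurv]
    simp only [map_add, map_sum, map_mul, hR, evalAt_Y_Y hU hL hpd, mul_assoc,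
      ← Finset.mul_sum]
    simp only [Matrix.mul_apply, of_apply] at h
    linear_combination 2 * h
  · rw [← hK p p.2 (WithLp.toLp 2 u) ((LinearIndependent.pair_iff' (hy p p.2)).2 fun c hc =>
      hu c (by rw [← WithLp.ofLp_smul, hc])), flagCurv_eq_div hg.isHermitian
      (dotProduct_fundTensor_self hU hL hpd hE p)]

/-- Pointwise, the symmetrized curvature is K times the Gram form. For n ≥ 2 the Gram form has a
nonzero entry at every point, so pairing with it and dividing by its sum of squares writes K as a
quotient of smooth functions. -/
theorem exists_represents_scalar (hn : 2 ≤ n) (hy : ∀ p ∈ U, p.2 ≠ 0)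
    (hK : ∀ p ∈ U, ∀ u : E n, LinearIndependent ℝ ![p.2, u] → flagCurv F p u = K p) :
    ∃ a : smoothFunctions U, Represents K a := by
  have hev := evalAt_symCurv hU hL hpd hE hy hK
  have hu : IsUnit (∑ m, ∑ k, gramForm hU L m k * gramForm hU L m k) := by
    refine isUnit_of_ne_zero fun p => ?_
    change evalAt p _ ≠ 0
    have hy' : (p : E n × E n).2.ofLp ≠ 0 := fun h0 => hy p p.2 (by ext i; simp [h0])
    obtain ⟨i, j, hij⟩ := gram_ne_zero (hpd p p.2) hy' hn
    have hij' : evalAt p (gramForm hU L i j) ≠ 0 := by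
      rw [evalAt_gramForm hU hL hpd hE]
      exact mul_ne_zero four_ne_zero hij
    simp only [map_sum, map_mul]
    have hnn : ∀ m k, 0 ≤ evalAt p (gramForm hU L m k) * evalAt p (gramForm hU L m k) :=
      fun m k => mul_self_nonneg _
    exact (Finset.sum_pos' (fun m _ => Finset.sum_nonneg fun k _ => hnn m k)
      ⟨i, Finset.mem_univ i, Finset.sum_pos' (fun k _ => hnn i k)
        ⟨j, Finset.mem_univ j, mul_self_pos.2 hij'⟩⟩).ne'
  obtain ⟨b, hb⟩ := hu.exists_right_inv
  refine ⟨(∑ m, ∑ k, symCurv hU L m k * gramForm hU L m k) * b, fun p => ?_⟩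
  change K p = evalAt p ((∑ m, ∑ k, symCurv hU L m k * gramForm hU L m k) * b)
  have h := congrArg (evalAt p) hb
  simp only [map_sum, map_mul, map_one, hev, mul_assoc, ← Finset.mul_sum] at h ⊢
  rw [h, mul_one]

theorem cyclic_sum_vertHor (hn : 3 ≤ n) (hsm : ContDiffOn ℝ ∞ F U) (hF : ∀ p ∈ U, F p ≠ 0)
    (hy : ∀ p ∈ U, p.2 ≠ 0)
    (hK : ∀ p ∈ U, ∀ u : E n, LinearIndependent ℝ ![p.2, u] → flagCurv F p u = K p)
    (p : U) (i j k : Fin n) :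
    (vertHor F K j i p - vertHor F K i j p) * dy k F p
      + (vertHor F K i k p - vertHor F K k i p) * dy j F p
      + (vertHor F K k j p - vertHor F K j k p) * dy i F p = 0 := by
  obtain ⟨a, ha⟩ := exists_represents_scalar hU hL hpd hE (by omega) hy hK
  have hG := represents_geodCoeff hU hL hpd
  have hs : ∀ m k, symCurv hU L m k = a * gramForm hU L m k := fun m k => ext_evalAt fun p => by
    rw [evalAt_symCurv hU hL hpd hE hy hK, map_mul, ha.evalAt p]
  have h := congrArg (evalAt p) (hE.cyclic_sum hs (by simpa using hn) i j k)
  have hf := represents_ofContDiffOn hsm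
  have hLf : L = ofContDiffOn hsm * ofContDiffOn hsm :=
    ext_evalAt fun p => by rw [map_mul, hL.evalAt p, hf.evalAt p, sq]
  have hY : ∀ k, evalAt p ((coordCalculus hU).Y k L) = 2 * F p * dy k F p := by
    intro k
    rw [hLf, Calculus.derivation_mul, map_add, map_mul, map_mul, hf.evalAt p,
      (hf.dy hU k).evalAt p]
    ring
  simp only [map_add, map_mul, map_sub, map_zero, hY,
    (represents_vertHor hG ha hU _ _).evalAt p] at h
  -- The abstract identity involves L_{·k} = 2F F_{·k}; the common factor 2F is removed.
  refine mul_left_cancel₀ (mul_ne_zero two_ne_zero (hF p p.2)) ?_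
  linear_combination h

end LocalFinsler
end Finsler

theorem mainTheorem5 {n : ℕ} {M : Type*} [TopologicalSpace M] [ChartedSpace (Finsler.E n) M]
    [IsManifold (𝓡 n) ∞ M] (F K : TangentBundle (𝓡 n) M → ℝ)
    (hF : Finsler.IsFinslerMetric F) (hK : Finsler.HasScalarFlagCurvature F K)
    (φ : OpenPartialHomeomorph M (Finsler.E n))
    (hφ : φ ∈ IsManifold.maximalAtlas (𝓡 n) ∞ M)
    (x : Finsler.E n) (hx : x ∈ φ.target) (y : Finsler.E n) (hy : y ≠ 0) (i j k : Fin n) :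
    (Finsler.vertHor (Finsler.coordRep φ F) (Finsler.coordRep φ K) j i (x, y)
        - Finsler.vertHor (Finsler.coordRep φ F) (Finsler.coordRep φ K) i j (x, y))
      * Finsler.dy k (Finsler.coordRep φ F) (x, y)
    + (Finsler.vertHor (Finsler.coordRep φ F) (Finsler.coordRep φ K) i k (x, y)
        - Finsler.vertHor (Finsler.coordRep φ F) (Finsler.coordRep φ K) k i (x, y))
      * Finsler.dy j (Finsler.coordRep φ F) (x, y)
    + (Finsler.vertHor (Finsler.coordRep φ F) (Finsler.coordRep φ K) k j (x, y)
        - Finsler.vertHor (Finsler.coordRep φ F) (Finsler.coordRep φ K) j k (x, y))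
      * Finsler.dy i (Finsler.coordRep φ F) (x, y) = 0 := by
  by_cases hn : 3 ≤ n
  · have hU : IsOpen (φ.target ×ˢ ({0}ᶜ : Set (Finsler.E n))) :=
      φ.open_target.prod isOpen_compl_singleton
    have hsm := Finsler.contDiffOn_coordRep hF hφ
    have hpd : ∀ p ∈ φ.target ×ˢ ({0}ᶜ : Set (Finsler.E n)),
        (Finsler.fundTensor (Finsler.coordRep φ F) p).PosDef := fun p hp =>
      hF.strongly_convex φ hφ p.1 hp.1 p.2 hp.2
    have hne : ∀ p ∈ φ.target ×ˢ ({0}ᶜ : Set (Finsler.E n)), Finsler.coordRep φ F p ≠ 0 :=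
      fun p hp => Finsler.coordRep_ne_zero hF hφ hp
    have hL := Finsler.represents_ofContDiffOn (hsm.pow 2)
    refine Finsler.cyclic_sum_vertHor hU hL hpd
      (Finsler.isEnergy_of_finsler hU hL hpd hne fun p hp => ?_) hn hsm hne (fun p hp => hp.2)
      (fun p hp u hu => hK φ hφ p.1 hp.1 p.2 u hu) ⟨(x, y), hx, hy⟩ i j k
    have hd := (hsm.contDiffAt (hU.mem_nhds hp)).differentiableAt (by simp)
    rw [fderiv_fun_pow 2 hd]
    have he := Finsler.fderiv_self_of_homogeneous hd fun c hc =>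
      Finsler.coordRep_smul hF p.1 p.2 hc
    simp only [smul_apply, he, smul_eq_mul]
    simp only [nsmul_eq_mul]
    push_cast
    ring
  -- With at most two index values, two of i, j, k coincide and the alternating sum cancels.
  · have h : i = j ∨ j = k ∨ k = i := by omega
    rcases h with rfl | rfl | rfl <;> ring
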